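/- Let $\sigma_{\mathrm c}\in(0,+\infty)$ and let $f:[0,1)\to[0,+\infty)$ satisfy: - (f1) $f\in C^2([0,1))$ (one-sided derivatives at $0$) and $f^{-1}(0)=\{0\}$; - (f2) $\lim_{s\to1^-}(1-s)f(s)=\sigma_{\mathrm c}$; - (f3) $\frac{d}{ds}\bigl[(1-s)f(s)\bigr]>0$ for all $s\in(0,1)$; - (f4) $\frac{d}{ds}\Bigl[\frac{(1-s)f'(s)}{f(s)}\Bigr]<0$ for all $s\in(0,1)$; - (f5) $\lim_{s\to1^-}\frac{1}{(1-s)^3}\frac{d}{ds}\bigl[(1-s)f(s)\bigr]=+\infty$; - (f6) the map $s\mapsto\sqrt{s}\,f(1-\sqrt{s})$ is convex on $(0,1]$. For $s\ge0$ let $\mathcal U_s$ be the set of all pairs $(\alpha,\beta)\in H^1_{\mathrm{loc}}(\mathbb R)\times H^1_{\mathrm{loc}}(\mathbb R)$ (identified with their continuous representatives) such that $\alpha'\in L^1(\mathbb R)$, $\bigl|\int_{\mathbb R}\alpha'(t)\,dt\bigr|=s$, $0\le\beta\le1$ and $\lim_{|t|\to+\infty}\beta(t)=1$. Define $$g(s)=\inf_{(\alpha,\beta)\in\mathcal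 U_s}\int_{-\infty}^{+\infty}\Bigl(f^2(\beta)|\alpha'|^2+\frac{(1-\beta)^2}{4}+|\beta'|^2\Bigr)dt,$$ with the conventions $f(1)=+\infty$ and $\infty\cdot0=0$, and let $s_{\mathrm{frac}}=\sup\{s\ge0 : g(s)<1\}\in[0,+\infty]$. Then $f'(0)\ge0$ and $$s_{\mathrm{frac}}=\frac{\pi}{f'(0)},$$ where $s_{\mathrm{frac}}=+\infty$ if $f'(0)=0$. -/

import Mathlib

open MeasureTheory Set Filter Topology
open scoped ENNReal NNReal ContDiff

namespace CohesiveFracture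

/-- `u'` is a weak derivative of `u` on the real line. -/
def IsWeakDeriv (u u' : ℝ → ℝ) : Prop :=
  ∀ φ : ℝ → ℝ, ContDiff ℝ ∞ φ → HasCompactSupport φ →
    ∫ t, u t * deriv φ t = -∫ t, u' t * φ t

/-- `u` is (the continuous representative of) a function of class `H¹_loc(ℝ)` and `u'` is its weak
derivative. Since `u` is continuous, it belongs to `L²_loc(ℝ)`. -/
structure IsH1Loc (u u' : ℝ → ℝ) : Prop where
  continuous : Continuous u
  memLp_deriv : ∀ K : Set ℝ, IsCompact K → MemLp u' 2 (volume.restrict K)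
  isWeakDeriv : IsWeakDeriv u u'

/-- The pair `(α, β)`, with weak derivatives `(α', β')`, belongs to the admissible class `𝓤_s`. -/
structure IsAdmissible (s : ℝ) (α α' β β' : ℝ → ℝ) : Prop where
  h1_alpha : IsH1Loc α α'
  h1_beta : IsH1Loc β β'
  integrable_alpha' : Integrable α'
  abs_integral : |∫ t, α' t| = s
  nonneg : ∀ t, 0 ≤ β t
  le_one : ∀ t, β t ≤ 1
  tendsto_atTop : Tendsto β atTop (𝓝 1)
  tendsto_atBot : Tendsto β atBot (𝓝 1)

/-- The function `f : [0,1) → [0,∞)` extended to `[0,1]` by its limit `f(1) = +∞`. -/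
noncomputable def extend (f : ℝ → ℝ) (x : ℝ) : ℝ≥0∞ :=
  open Classical in if x < 1 then ENNReal.ofReal (f x) else ⊤

/-- The optimal profile energy
`𝓖(α, β) = ∫_ℝ ( f(β)² |α'|² + (1 - β)² / 4 + |β'|² ) dt ∈ [0, ∞]`,
with the conventions `f(1) = +∞` and `∞ · 0 = 0`. -/
noncomputable def energy (f : ℝ → ℝ) (α' β β' : ℝ → ℝ) : ℝ≥0∞ :=
  ∫⁻ t, (extend f (β t) ^ 2 * ENNReal.ofReal (|α' t| ^ 2)
    + ENNReal.ofReal ((1 - β t) ^ 2 / 4) + ENNReal.ofReal (|β' t| ^ 2))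

/-- The cohesive energy density `g(s) = inf { 𝓖(α, β) : (α, β) ∈ 𝓤_s }`. -/
noncomputable def g (f : ℝ → ℝ) (s : ℝ) : ℝ≥0∞ :=
  ⨅ (α : ℝ → ℝ) (α' : ℝ → ℝ) (β : ℝ → ℝ) (β' : ℝ → ℝ) (_ : IsAdmissible s α α' β β'),
    energy f α' β β'

/-- The threshold of complete fracture `s_frac = sup { s ≥ 0 : g(s) < 1 } ∈ [0, ∞]`. -/
noncomputable def sFrac (f : ℝ → ℝ) : ℝ≥0∞ :=
  sSup (ENNReal.ofReal '' {s : ℝ | 0 ≤ s ∧ g f s < 1})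

/-- The one-sided derivative `f'(0)` of a function on `[0,1)`. -/
noncomputable def derivZero (f : ℝ → ℝ) : ℝ := derivWithin f (Ico 0 1) 0

end CohesiveFracture

namespace CohesiveFracture

/-! The statement is about geodesics on a cone. By `x ^ 2 / 4 + y ^ 2 ≥ x * y` the energy dominates
the length of the curve `(β, α)` for the metric `(1 - β)² (dβ² + f(β)² dα²)`. With `r = β - β² / 2`,
so that `dr = (1 - β) dβ`, convexity (f6) gives `(1 - β) f(β) ≥ c r` for `c = f'(0)`. The length is
therefore at least that for the flat cone metric `dr² + c² r² dα²`. Both ends of an admissible curve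
tend to `r = 1/2` and its total angle is `c s`.

Lower bound (`one_le_energy`): if `c s > π`, no path on the cone is shorter than the one through the
apex, of length `1/2 + 1/2 = 1`. This is proved by calibration: `r cos(angle)` is 1-Lipschitz and is
used until the angle reaches `π`; afterwards `r` itself is used.

Upper bound (`g_lt_one`): if `c s < π`, choose `C > c` with `C s < π`. Near the apex `f(b) ≤ C b`,
and cutting the corner with a straight chord at small distance `δ` beats the path through the apex.
If `c = 0` this works for every `s > 0`. -/

/-! ### Weak derivatives, primitives and absolute continuity -/

theorem _root_.AbsolutelyContinuousOnInterval.lipschitz_comp {φ u : ℝ → ℝ} {K : ℝ≥0} {a b : ℝ}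
    (hφ : LipschitzWith K φ) (hu : AbsolutelyContinuousOnInterval u a b) :
    AbsolutelyContinuousOnInterval (fun t => φ (u t)) a b := by
  refine squeeze_zero (fun t => Finset.sum_nonneg fun i _ => dist_nonneg) (fun t => ?_)
    (hu.const_mul (K : ℝ))
  refine Finset.sum_le_sum fun i _ => (hφ.dist_le_mul _ _).trans_eq ?_
  simp [Real.dist_eq, ← mul_sub, abs_mul]

theorem contDiff_absolutelyContinuousOnInterval {φ : ℝ → ℝ} (hφ : ContDiff ℝ ∞ φ) (a b : ℝ) :
    AbsolutelyContinuousOnInterval φ a b :=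
  ((hφ.of_le (by exact_mod_cast le_top)).contDiffOn).absolutelyContinuousOnInterval

theorem exists_Ioc_of_hasCompactSupport {φ : ℝ → ℝ} (hφ : HasCompactSupport φ) :
    ∃ R : ℝ, 0 < R ∧ φ (-R) = 0 ∧ φ R = 0 ∧ tsupport φ ⊆ Ioc (-R) R := by
  obtain ⟨R, hR⟩ := hφ.isBounded.subset_closedBall 0
  have hR' : ∀ x, x ∈ tsupport φ → |x| ≤ R := fun x hx => by simpa using hR hx
  have key : ∀ x, |R| + 1 ≤ |x| → φ x = 0 := fun x hx => by
    by_contra h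
    have := hR' x (subset_tsupport _ h)
    linarith [le_abs_self R]
  have h0 : 0 < |R| + 1 := by positivity
  refine ⟨|R| + 1, h0, key _ ?_, key _ ?_, fun x hx => ?_⟩
  · rw [abs_neg, abs_of_pos h0]
  · rw [abs_of_pos h0]
  · have := abs_le.1 (hR' x hx)
    constructor <;> linarith [le_abs_self R]

theorem intervalIntegrable_of_locallyIntegrable {u : ℝ → ℝ} (hu : LocallyIntegrable u) (a b : ℝ) :
    IntervalIntegrable u volume a b :=
  (hu.integrableOn_isCompact isCompact_uIcc).intervalIntegrable

/-- A primitive of a locally integrable function is absolutely continuous. -/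
theorem absolutelyContinuousOnInterval_of_primitive {u u' : ℝ → ℝ} (hu' : LocallyIntegrable u')
    (hu : ∀ a b, ∫ t in a..b, u' t = u b - u a) (a b : ℝ) :
    AbsolutelyContinuousOnInterval u a b := by
  have h := (intervalIntegrable_of_locallyIntegrable hu' a b).absolutelyContinuousOnInterval_intervalIntegral
    (c := a) left_mem_uIcc
  have h2 : AbsolutelyContinuousOnInterval (fun _ : ℝ => u a) a b :=
    (contDiff_const (c := u a) (n := 1)).contDiffOn.absolutelyContinuousOnInterval
  have h3 : u = (fun x => ∫ t in a..x, u' t) + fun _ => u a := by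
    funext x
    simp [hu]
  rw [h3]
  exact h.add h2

theorem ae_hasDerivAt_of_primitive {u u' : ℝ → ℝ} (hu' : LocallyIntegrable u')
    (hu : ∀ a b, ∫ t in a..b, u' t = u b - u a) : ∀ᵐ t, HasDerivAt u (u' t) t := by
  filter_upwards [_root_.LocallyIntegrable.ae_hasDerivAt_integral hu'] with t ht
  have h : u = fun x => (∫ t in (0 : ℝ)..x, u' t) + u 0 := by
    funext x
    simp [hu]
  rw [h]
  exact (ht 0).add_const (u 0)

theorem isWeakDeriv_of_primitive {u u' : ℝ → ℝ} (hu' : LocallyIntegrable u')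
    (hu : ∀ a b, ∫ t in a..b, u' t = u b - u a) : IsWeakDeriv u u' := by
  intro φ hφ hc
  obtain ⟨R, hR, h1, h2, hsub⟩ := exists_Ioc_of_hasCompactSupport hc
  have hle : -R ≤ R := by linarith
  have e1 : ∫ t, u t * deriv φ t = ∫ t in -R..R, u t * deriv φ t := by
    rw [intervalIntegral.integral_of_le hle, setIntegral_eq_integral_of_forall_compl_eq_zero]
    intro t ht
    have : t ∉ tsupport (deriv φ) := fun h => ht (hsub (tsupport_deriv_subset h))
    rw [image_eq_zero_of_notMem_tsupport this, mul_zero]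
  have e2 : ∫ t, u' t * φ t = ∫ t in -R..R, u' t * φ t := by
    rw [intervalIntegral.integral_of_le hle, setIntegral_eq_integral_of_forall_compl_eq_zero]
    intro t ht
    rw [image_eq_zero_of_notMem_tsupport (fun h => ht (hsub h)), mul_zero]
  rw [e1, e2, (absolutelyContinuousOnInterval_of_primitive hu' hu _ _).integral_mul_deriv_eq_deriv_mul
    (contDiff_absolutelyContinuousOnInterval hφ _ _), h1, h2]
  have : ∫ t in -R..R, deriv u t * φ t = ∫ t in -R..R, u' t * φ t := by
    apply intervalIntegral.integral_congr_ae
    filter_upwards [ae_hasDerivAt_of_primitive hu' hu] with t ht _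
    rw [ht.deriv]
  rw [this]; ring

/-- A smooth compactly supported function of zero mean is the derivative of a smooth compactly
supported function. -/
theorem exists_deriv_eq_of_integral_eq_zero {φ : ℝ → ℝ} (hφ : ContDiff ℝ ∞ φ)
    (hc : HasCompactSupport φ) (h0 : ∫ t, φ t = 0) :
    ∃ χ : ℝ → ℝ, ContDiff ℝ ∞ χ ∧ HasCompactSupport χ ∧ deriv χ = φ := by
  obtain ⟨R, hR, h1, h2, hsub⟩ := exists_Ioc_of_hasCompactSupport hc
  have hle : -R ≤ R := by linarith
  have hI : ∀ a b, IntervalIntegrable φ volume a b := fun a b =>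
    hφ.continuous.intervalIntegrable a b
  have hd : ∀ t, HasDerivAt (fun x => ∫ y in -R..x, φ y) (φ t) t := fun t =>
    intervalIntegral.integral_hasDerivAt_right (hI _ _)
      hφ.continuous.stronglyMeasurable.stronglyMeasurableAtFilter hφ.continuous.continuousAt
  have hderiv : deriv (fun x => ∫ y in -R..x, φ y) = φ := funext fun t => (hd t).deriv
  have hz : ∀ a b, (∀ x ∈ uIoc a b, x ∉ Ioc (-R) R) → ∫ y in a..b, φ y = 0 := fun a b hab => by
    refine intervalIntegral.integral_zero_ae (Eventually.of_forall fun x hx => ?_)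
    exact image_eq_zero_of_notMem_tsupport fun h => hab x hx (hsub h)
  have htot : ∫ y in -R..R, φ y = 0 := by
    rw [intervalIntegral.integral_of_le hle, setIntegral_eq_integral_of_forall_compl_eq_zero, h0]
    exact fun t ht => image_eq_zero_of_notMem_tsupport (fun h => ht (hsub h))
  refine ⟨fun x => ∫ y in -R..x, φ y, ?_, ?_, hderiv⟩
  · rw [contDiff_infty_iff_deriv, hderiv]
    exact ⟨fun t => (hd t).differentiableAt, hφ⟩
  · refine HasCompactSupport.intro (isCompact_Icc (a := -R) (b := R)) fun x hx => ?_
    rcases lt_or_ge x (-R) with h | h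
    · refine hz _ _ fun y hy => ?_
      rw [uIoc_of_ge h.le] at hy
      exact fun hy' => absurd hy.2 (not_le.2 hy'.1)
    · have hRx : R < x := by
        by_contra h'
        exact hx ⟨h, not_lt.1 h'⟩
      rw [← intervalIntegral.integral_add_adjacent_intervals (hI (-R) R) (hI R x), htot, zero_add]
      refine hz _ _ fun y hy => ?_
      rw [uIoc_of_le hRx.le] at hy
      exact fun hy' => absurd hy.1 (not_lt.2 hy'.2)

/-- **Du Bois-Reymond lemma** for continuous functions. -/
theorem eq_const_of_isWeakDeriv_zero {v : ℝ → ℝ} (hv : Continuous v)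
    (h : IsWeakDeriv v 0) (a b : ℝ) : v a = v b := by
  let ρ : ContDiffBump (0 : ℝ) := ⟨1, 2, one_pos, one_lt_two⟩
  let η : ℝ → ℝ := ρ.normed volume
  have hη : ContDiff ℝ ∞ η := ρ.contDiff_normed
  have hηc : HasCompactSupport η := ρ.hasCompactSupport_normed
  have hη1 : ∫ t, η t = 1 := ρ.integral_normed
  have hηi : Integrable η := hη.continuous.integrable_of_hasCompactSupport hηc
  set m := ∫ t, v t * η t with hm
  have hae : ∀ᵐ t, v t = m := by
    refine ae_eq_of_integral_contDiff_smul_eq hv.locallyIntegrable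
      (continuous_const.locallyIntegrable) fun φ hφ hφc => ?_
    have hφi : Integrable φ := hφ.continuous.integrable_of_hasCompactSupport hφc
    -- Subtracting the multiple of the unit-mass bump `η` with the same integral leaves a function
    -- of zero mean, which is an admissible `deriv χ`.
    obtain ⟨χ, hχ, hχc, hχd⟩ := exists_deriv_eq_of_integral_eq_zero
      (φ := fun t => φ t - (∫ y, φ y) * η t) (hφ.sub (contDiff_const.mul hη))
      (hφc.sub hηc.mul_left) (by
        rw [integral_sub hφi (hηi.const_mul _), integral_const_mul, hη1]; ring)
    have h1 := h χ hχ hχc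
    rw [hχd] at h1
    have i1 : Integrable fun t => v t * φ t :=
      (hv.mul hφ.continuous).integrable_of_hasCompactSupport hφc.mul_left
    have i2 : Integrable fun t => v t * η t :=
      (hv.mul hη.continuous).integrable_of_hasCompactSupport hηc.mul_left
    have e : (fun t => v t * (φ t - (∫ y, φ y) * η t)) =
        fun t => v t * φ t - (∫ y, φ y) * (v t * η t) := by
      ext t; ring
    rw [e, integral_sub i1 (i2.const_mul _), integral_const_mul, ← hm] at h1
    simp only [Pi.zero_apply, zero_mul, integral_zero, neg_zero] at h1
    simp only [smul_eq_mul]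
    rw [integral_mul_const]
    simp_rw [mul_comm (φ _)]
    linarith
  have := (Continuous.ae_eq_iff_eq volume hv (continuous_const (y := m))).1 hae
  rw [this]

theorem IsH1Loc.locallyIntegrable {u u' : ℝ → ℝ} (h : IsH1Loc u u') : LocallyIntegrable u' := by
  rw [locallyIntegrable_iff]
  intro K hK
  have : IsFiniteMeasure (volume.restrict K) := ⟨by simpa using hK.measure_lt_top⟩
  exact (h.memLp_deriv K hK).integrable (by norm_num)

/-- The primitive `U` of `u'` has the same weak derivative as `u`, so `u - U` is constant by Du
Bois-Reymond. This turns the distributional definition into the fundamental theorem of calculus. -/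
theorem IsH1Loc.integral_eq_sub {u u' : ℝ → ℝ} (h : IsH1Loc u u') (a b : ℝ) :
    ∫ t in a..b, u' t = u b - u a := by
  have hi := h.locallyIntegrable
  have hI : ∀ a b, IntervalIntegrable u' volume a b := intervalIntegrable_of_locallyIntegrable hi
  set U : ℝ → ℝ := fun x => ∫ t in (0 : ℝ)..x, u' t with hU
  have hUsub : ∀ a b, ∫ t in a..b, u' t = U b - U a := fun a b =>
    (intervalIntegral.integral_interval_sub_left (hI _ _) (hI _ _)).symm
  have hUc : Continuous U := intervalIntegral.continuous_primitive hI 0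
  have hw := isWeakDeriv_of_primitive hi hUsub
  have hconst := eq_const_of_isWeakDeriv_zero (v := fun t => u t - U t) (h.continuous.sub hUc)
    (fun φ hφ hc => by
      have hd : Continuous (deriv φ) := (hφ.continuous_deriv (by simp))
      have i1 : Integrable fun t => u t * deriv φ t :=
        (h.continuous.mul hd).integrable_of_hasCompactSupport hc.deriv.mul_left
      have i2 : Integrable fun t => U t * deriv φ t :=
        (hUc.mul hd).integrable_of_hasCompactSupport hc.deriv.mul_left
      simp only [sub_mul]
      rw [integral_sub i1 i2, h.isWeakDeriv φ hφ hc, hw φ hφ hc]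
      simp) a b
  rw [hUsub]
  linarith

theorem IsH1Loc.absolutelyContinuousOnInterval {u u' : ℝ → ℝ} (h : IsH1Loc u u') (a b : ℝ) :
    AbsolutelyContinuousOnInterval u a b :=
  absolutelyContinuousOnInterval_of_primitive h.locallyIntegrable h.integral_eq_sub a b

theorem IsH1Loc.ae_hasDerivAt {u u' : ℝ → ℝ} (h : IsH1Loc u u') :
    ∀ᵐ t, HasDerivAt u (u' t) t :=
  ae_hasDerivAt_of_primitive h.locallyIntegrable h.integral_eq_sub

/-- A continuous function with bounded measurable derivative off a countable set is of class
`H¹_loc`. -/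
theorem isH1Loc_of_hasDerivAt_off_countable {u u' : ℝ → ℝ} {S : Set ℝ} {M : ℝ} (hS : S.Countable)
    (hu : Continuous u) (hm : Measurable u') (hb : ∀ t, |u' t| ≤ M)
    (hd : ∀ t ∉ S, HasDerivAt u (u' t) t) : IsH1Loc u u' := by
  have hmem : ∀ K : Set ℝ, IsCompact K → MemLp u' 2 (volume.restrict K) := fun K hK => by
    have : IsFiniteMeasure (volume.restrict K) := ⟨by simpa using hK.measure_lt_top⟩
    exact MemLp.of_bound hm.aestronglyMeasurable M (Eventually.of_forall hb)
  have hi : LocallyIntegrable u' := by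
    rw [locallyIntegrable_iff]
    intro K hK
    have : IsFiniteMeasure (volume.restrict K) := ⟨by simpa using hK.measure_lt_top⟩
    exact (hmem K hK).integrable (by norm_num)
  refine ⟨hu, hmem, isWeakDeriv_of_primitive hi fun a b => ?_⟩
  exact integral_eq_of_hasDerivAt_off_countable u u' hS hu.continuousOn
    (fun x hx => hd x hx.2) (intervalIntegrable_of_locallyIntegrable hi a b)

/-! ### Slope at the origin and comparison with a flat cone -/

theorem tendsto_div_derivZero {f : ℝ → ℝ} (hf : ContDiffOn ℝ 2 f (Ico 0 1)) (h0 : f 0 = 0) :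
    Tendsto (fun b => f b / b) (𝓝[>] 0) (𝓝 (derivZero f)) := by
  have hd : HasDerivWithinAt f (derivZero f) (Ico 0 1) 0 :=
    (hf.differentiableOn (by norm_num) 0 (by simp)).hasDerivWithinAt
  rw [hasDerivWithinAt_iff_tendsto_slope] at hd
  have hle : 𝓝[>] (0 : ℝ) ≤ 𝓝[Ico 0 1 \ {0}] 0 := by
    refine nhdsWithin_le_iff.2 ?_
    filter_upwards [Ioo_mem_nhdsGT (zero_lt_one (α := ℝ))] with x hx
    exact ⟨⟨hx.1.le, hx.2⟩, hx.1.ne'⟩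
  refine (hd.mono_left hle).congr fun b => ?_
  simp [slope_def_field, h0]

theorem derivZero_nonneg {f : ℝ → ℝ} (hf : ContDiffOn ℝ 2 f (Ico 0 1)) (h0 : f 0 = 0)
    (hnn : ∀ s ∈ Ico (0 : ℝ) 1, 0 ≤ f s) : 0 ≤ derivZero f := by
  refine ge_of_tendsto (tendsto_div_derivZero hf h0) ?_
  filter_upwards [Ioo_mem_nhdsGT (zero_lt_one (α := ℝ))] with x hx
  exact div_nonneg (hnn x ⟨hx.1.le, hx.2⟩) hx.1.le

/-- The convex function of (f6) vanishes at `1`, so its chord slopes towards `1` are monotone. At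
the point `(1 - b) ^ 2` the slope is, up to sign, `(1 - b) * f b / (2 * b - b ^ 2)`, and as `b → 0`
this quotient tends to half of `derivZero f`. -/
theorem derivZero_mul_le {f : ℝ → ℝ} (hf : ContDiffOn ℝ 2 f (Ico 0 1)) (h0 : f 0 = 0)
    (hconv : ConvexOn ℝ (Ioc 0 1) (fun s : ℝ => √s * f (1 - √s))) {b : ℝ} (hb : b ∈ Ico (0 : ℝ) 1) :
    derivZero f * (b - b ^ 2 / 2) ≤ (1 - b) * f b := by
  rcases hb.1.eq_or_lt with rfl | hb0
  · simp [h0]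
  have hb1 := hb.2
  -- Slope comparison between `(1 - x) ^ 2` and `(1 - b) ^ 2`, cleared of denominators; `2 - x`
  -- comes from `1 - (1 - x) ^ 2 = x * (2 - x)`.
  have key : ∀ x ∈ Ioo 0 b, (1 - x) * (f x / x) * (2 * b - b ^ 2) ≤ (1 - b) * f b * (2 - x) := by
    intro x hx
    have hx1 : x < 1 := hx.2.trans hb1
    have hB : 0 < 1 - (1 - b) ^ 2 := by nlinarith
    have hX : 0 < 1 - (1 - x) ^ 2 := by nlinarith [hx.1]
    have hXB : 1 - (1 - x) ^ 2 ≤ 1 - (1 - b) ^ 2 := by nlinarith [hx.1, hx.2]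
    have h := hconv.2 (show (1 - b) ^ 2 ∈ Ioc (0 : ℝ) 1 from ⟨pow_pos (by linarith) 2, by linarith⟩)
      (show (1 : ℝ) ∈ Ioc (0 : ℝ) 1 by simp) (div_pos hX hB).le
      (sub_nonneg.2 ((div_le_one hB).2 hXB)) (add_sub_cancel _ _)
    have e : (1 - (1 - x) ^ 2) / (1 - (1 - b) ^ 2) * (1 - b) ^ 2 +
        (1 - (1 - (1 - x) ^ 2) / (1 - (1 - b) ^ 2)) * 1 = (1 - x) ^ 2 := by
      field_simp; ring
    simp only [smul_eq_mul] at h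
    rw [e, Real.sqrt_sq (by linarith), Real.sqrt_sq (by linarith)] at h
    simp only [Real.sqrt_one, sub_self, h0, mul_zero, add_zero, sub_sub_cancel] at h
    rw [div_mul_eq_mul_div, le_div_iff₀ hB] at h
    have hx0 := hx.1
    have e2 : (1 - x) * (f x / x) * (2 * b - b ^ 2) = ((1 - x) * f x * (1 - (1 - b) ^ 2)) / x := by
      field_simp; ring
    rw [e2, div_le_iff₀ hx0]
    linarith
  have hx : Tendsto (fun x : ℝ => x) (𝓝[>] 0) (𝓝 0) := tendsto_nhdsWithin_of_tendsto_nhds tendsto_id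
  have l1 := ((tendsto_const_nhds (x := (1 : ℝ))).sub hx).mul (tendsto_div_derivZero hf h0)
    |>.mul_const (2 * b - b ^ 2)
  have l2 := ((tendsto_const_nhds (x := (2 : ℝ))).sub hx).const_mul ((1 - b) * f b)
  have := le_of_tendsto_of_tendsto l1 l2 (by
    filter_upwards [Ioo_mem_nhdsGT hb0] with x hx using key x hx)
  linarith

/-! ### Lower bound by calibration -/

/-- Pointwise calibration inequality: Cauchy–Schwarz against `(p, q)` bounds the left side by `r *
m` with `m ^ 2 ≤ X ^ 2 + (F * Y) ^ 2`, and `r * m ≤ r ^ 2 / 4 + m ^ 2`. It is meant for `r = 1 - β`,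
`v = β - β ^ 2 / 2`, `F = f β`, `X = β'`, `Y = α'`. -/
theorem abs_sub_le_of_sq_add_sq_le_one {r v c X Y F p q : ℝ} (hr : 0 ≤ r) (hv : 0 ≤ v) (hc : 0 ≤ c)
    (hcv : c * v ≤ r * F) (hpq : p ^ 2 + q ^ 2 ≤ 1) :
    |r * X * p - v * c * Y * q| ≤ F ^ 2 * |Y| ^ 2 + r ^ 2 / 4 + |X| ^ 2 := by
  have h1 : |r * X * p - v * c * Y * q| ≤ r * (|X| * |p|) + c * v * (|Y| * |q|) := by
    refine (abs_sub _ _).trans_eq ?_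
    simp only [abs_mul, abs_of_nonneg hr, abs_of_nonneg hv, abs_of_nonneg hc]
    ring
  have h2 : c * v * (|Y| * |q|) ≤ r * F * (|Y| * |q|) :=
    mul_le_mul_of_nonneg_right hcv (by positivity)
  have h3 : (|X| * |p| + F * |Y| * |q|) ^ 2 ≤ (|X| ^ 2 + (F * |Y|) ^ 2) * (p ^ 2 + q ^ 2) := by
    rw [← sq_abs p, ← sq_abs q]
    nlinarith [sq_nonneg (|X| * |q| - F * |Y| * |p|)]
  have h4 : (|X| ^ 2 + (F * |Y|) ^ 2) * (p ^ 2 + q ^ 2) ≤ |X| ^ 2 + (F * |Y|) ^ 2 :=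
    mul_le_of_le_one_right (by positivity) hpq
  nlinarith [sq_nonneg (r / 2 - (|X| * |p| + F * |Y| * |q|))]

theorem ofReal_abs_sub_le_integrand {f : ℝ → ℝ} {c b X Y p q : ℝ} (hc : 0 ≤ c) (hb0 : 0 ≤ b)
    (hb1 : b ≤ 1) (hf : b < 1 → 0 ≤ f b ∧ c * (b - b ^ 2 / 2) ≤ (1 - b) * f b)
    (hpq : p ^ 2 + q ^ 2 ≤ 1) :
    ENNReal.ofReal |(1 - b) * X * p - (b - b ^ 2 / 2) * c * Y * q| ≤
      extend f b ^ 2 * ENNReal.ofReal (|Y| ^ 2) + ENNReal.ofReal ((1 - b) ^ 2 / 4)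
        + ENNReal.ofReal (|X| ^ 2) := by
  rcases hb1.lt_or_eq with h | rfl
  · rw [extend, if_pos h, ← ENNReal.ofReal_pow (hf h).1, ← ENNReal.ofReal_mul (by positivity),
      ← ENNReal.ofReal_add (by positivity) (by positivity),
      ← ENNReal.ofReal_add (by positivity) (by positivity)]
    exact ENNReal.ofReal_le_ofReal
      (abs_sub_le_of_sq_add_sq_le_one (by linarith) (by nlinarith) hc (hf h).2 hpq)
  -- At `b = 1` the angular term on the left need not vanish; it does if `Y = 0`, and otherwise the
  -- right side is `⊤`.
  · rcases eq_or_ne Y 0 with rfl | hY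
    · simp
    · rw [extend, if_neg (lt_irrefl _)]
      simp [ENNReal.top_mul, hY]

theorem ofReal_abs_sub_le_setLIntegral {W w : ℝ → ℝ} {h : ℝ → ℝ≥0∞} {a b : ℝ} (hab : a ≤ b)
    (hW : AbsolutelyContinuousOnInterval W a b) (hd : ∀ᵐ t, HasDerivAt W (w t) t)
    (hle : ∀ t, ENNReal.ofReal |w t| ≤ h t) :
    ENNReal.ofReal |W b - W a| ≤ ∫⁻ t in Ioc a b, h t := by
  rw [← hW.integral_deriv_eq_sub, intervalIntegral.integral_of_le hab, ← Real.norm_eq_abs,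
    ofReal_norm]
  refine (enorm_integral_le_lintegral_enorm _).trans (lintegral_mono_ae ?_)
  filter_upwards [ae_restrict_of_ae hd] with t ht
  rw [ht.deriv, ← ofReal_norm, Real.norm_eq_abs]
  exact hle t

theorem tendsto_atBot_of_integrable_deriv {u u' : ℝ → ℝ} (h : IsH1Loc u u') (hi : Integrable u') :
    Tendsto u atBot (𝓝 (u 0 - ∫ t in Iic 0, u' t)) := by
  have := (intervalIntegral_tendsto_integral_Iic 0 hi.integrableOn tendsto_id).const_sub (u 0)
  refine this.congr fun x => ?_
  rw [h.integral_eq_sub]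
  simp

theorem tendsto_atTop_of_integrable_deriv {u u' : ℝ → ℝ} (h : IsH1Loc u u') (hi : Integrable u') :
    Tendsto u atTop (𝓝 (u 0 + ∫ t in Ioi 0, u' t)) := by
  have := (intervalIntegral_tendsto_integral_Ioi 0 hi.integrableOn tendsto_id).const_add (u 0)
  refine this.congr fun x => ?_
  rw [h.integral_eq_sub]
  simp

/-- A curve whose total angle exceeds `π` has length at least that of the path through the pole. -/
theorem one_le_energy {f : ℝ → ℝ} {c s : ℝ} {α α' β β' : ℝ → ℝ} (hc : 0 ≤ c)
    (hf : ∀ b ∈ Ico (0 : ℝ) 1, 0 ≤ f b ∧ c * (b - b ^ 2 / 2) ≤ (1 - b) * f b)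
    (h : IsAdmissible s α α' β β') (hs : Real.pi < c * s) : 1 ≤ energy f α' β β' := by
  -- `A` is the limit of `α` at `-∞`, the origin of angles.
  set A := α 0 - ∫ t in Iic 0, α' t with hA
  have hbot : Tendsto (fun t => c * |α t - A|) atBot (𝓝 0) := by
    have := (((tendsto_atBot_of_integrable_deriv h.h1_alpha h.integrable_alpha').sub_const A).abs).const_mul c
    simpa [← hA] using this
  have htop : Tendsto (fun t => c * |α t - A|) atTop (𝓝 (c * s)) := by
    have := (((tendsto_atTop_of_integrable_deriv h.h1_alpha h.integrable_alpha').sub_const A).abs).const_mul c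
    have e : |α 0 + (∫ t in Ioi 0, α' t) - A| = s := by
      rw [← h.abs_integral, ← intervalIntegral.integral_Iic_add_Ioi (b := 0)
        h.integrable_alpha'.integrableOn h.integrable_alpha'.integrableOn]
      congr 1
      rw [hA]; ring
    rwa [e] at this
  have hcont : Continuous fun t => c * |α t - A| :=
    continuous_const.mul (h.h1_alpha.continuous.sub continuous_const).abs
  -- The angle swept runs from `0` to `c * s > π`, hence equals `π` at some time; the absolute value
  -- makes the orientation of the curve irrelevant.
  obtain ⟨T, hT⟩ : ∃ T, c * |α T - A| = Real.pi := by
    obtain ⟨x, hx⟩ := (hbot.eventually (gt_mem_nhds Real.pi_pos)).exists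
    obtain ⟨y, hy⟩ := (htop.eventually (lt_mem_nhds hs)).exists
    exact mem_range_of_exists_le_of_exists_ge hcont ⟨x, hx.le⟩ ⟨y, hy.le⟩
  have hcosT : Real.cos (c * (α T - A)) = -1 := by
    rw [← Real.cos_abs, abs_mul, abs_of_nonneg hc, hT, Real.cos_pi]
  set I : ℝ → ℝ≥0∞ := fun t => extend f (β t) ^ 2 * ENNReal.ofReal (|α' t| ^ 2)
    + ENNReal.ofReal ((1 - β t) ^ 2 / 4) + ENNReal.ofReal (|β' t| ^ 2) with hI
  set V : ℝ → ℝ := fun t => β t - β t ^ 2 / 2 with hV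
  set W : ℝ → ℝ := fun t => V t * Real.cos (c * (α t - A)) with hW
  have acβ := h.h1_beta.absolutelyContinuousOnInterval
  have acV : ∀ a b, AbsolutelyContinuousOnInterval V a b := fun a b => by
    have e : V = fun t => β t - (1 / 2) * (β t * β t) := by
      funext t; simp only [hV]; ring
    rw [e]
    exact (acβ a b).fun_sub (((acβ a b).fun_mul (acβ a b)).const_mul (1 / 2))
  have acW : ∀ a b, AbsolutelyContinuousOnInterval W a b := fun a b => by
    have hl : LipschitzWith 1 Real.cos := Real.lipschitzWith_cos
    have h1 : AbsolutelyContinuousOnInterval (fun _ : ℝ => A) a b :=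
      (contDiff_const (c := A) (n := 1)).contDiffOn.absolutelyContinuousOnInterval
    exact (acV a b).fun_mul (AbsolutelyContinuousOnInterval.lipschitz_comp hl
      (((h.h1_alpha.absolutelyContinuousOnInterval a b).fun_sub h1).const_mul c))
  have dV : ∀ᵐ t, HasDerivAt V ((1 - β t) * β' t) t := by
    filter_upwards [h.h1_beta.ae_hasDerivAt] with t ht
    refine (ht.sub ((ht.pow 2).div_const 2)).congr_deriv ?_
    simp; ring
  have dW : ∀ᵐ t, HasDerivAt W ((1 - β t) * β' t * Real.cos (c * (α t - A))
      - (β t - β t ^ 2 / 2) * c * α' t * Real.sin (c * (α t - A))) t := by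
    filter_upwards [dV, h.h1_alpha.ae_hasDerivAt] with t h1 h2
    refine (h1.mul ((h2.sub_const A).const_mul c).cos).congr_deriv ?_
    simp only [hV]; ring
  have hfb : ∀ t, β t < 1 → 0 ≤ f (β t) ∧ c * (β t - β t ^ 2 / 2) ≤ (1 - β t) * f (β t) :=
    fun t ht => hf _ ⟨h.nonneg t, ht⟩
  have lW : ∀ a b, a ≤ b → ENNReal.ofReal |W b - W a| ≤ ∫⁻ t in Ioc a b, I t := fun a b hab =>
    ofReal_abs_sub_le_setLIntegral hab (acW a b) dW fun t =>
      ofReal_abs_sub_le_integrand hc (h.nonneg t) (h.le_one t) (hfb t)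
        (Real.cos_sq_add_sin_sq _).le
  have lV : ∀ a b, a ≤ b → ENNReal.ofReal |V b - V a| ≤ ∫⁻ t in Ioc a b, I t := fun a b hab =>
    ofReal_abs_sub_le_setLIntegral hab (acV a b) dV fun t => by
      have := ofReal_abs_sub_le_integrand (X := β' t) (Y := α' t) (p := 1) (q := 0) hc
        (h.nonneg t) (h.le_one t) (hfb t) (by norm_num)
      rwa [mul_one, mul_zero, sub_zero] at this
  have hWT : W T = -V T := by simp only [hW, hcosT]; ring
  -- At `T` the potential `W` equals `-V`, so the drop of `W` on `(-R, T]` and the growth of `V` on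
  -- `(T, R]` add up with `V T` cancelling.
  have bound : ∀ R, |T| ≤ R → ENNReal.ofReal (V R + W (-R)) ≤ energy f α' β β' := fun R hR => by
    have hT' := abs_le.1 hR
    calc ENNReal.ofReal (V R + W (-R)) ≤ ENNReal.ofReal (|W T - W (-R)| + |V R - V T|) := by
          refine ENNReal.ofReal_le_ofReal ?_
          have h1 := neg_le_abs (W T - W (-R))
          have h2 := le_abs_self (V R - V T)
          rw [hWT] at h1 ⊢
          linarith
      _ = ENNReal.ofReal |W T - W (-R)| + ENNReal.ofReal |V R - V T| :=
          ENNReal.ofReal_add (abs_nonneg _) (abs_nonneg _)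
      _ ≤ (∫⁻ t in Ioc (-R) T, I t) + ∫⁻ t in Ioc T R, I t :=
          add_le_add (lW _ _ hT'.1) (lV _ _ hT'.2)
      _ = ∫⁻ t in Ioc (-R) T ∪ Ioc T R, I t :=
          (lintegral_union measurableSet_Ioc (Ioc_disjoint_Ioc_of_le le_rfl)).symm
      _ ≤ ∫⁻ t, I t := setLIntegral_le_lintegral _ _
  have hVtop : Tendsto V atTop (𝓝 (1 / 2)) := by
    have := h.tendsto_atTop.sub ((h.tendsto_atTop.pow 2).div_const 2)
    convert this using 2; norm_num
  have hVbot : Tendsto V atBot (𝓝 (1 / 2)) := by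
    have := h.tendsto_atBot.sub ((h.tendsto_atBot.pow 2).div_const 2)
    convert this using 2; norm_num
  have hcosbot : Tendsto (fun t => Real.cos (c * (α t - A))) atBot (𝓝 1) := by
    have := (Real.continuous_cos.tendsto 0).comp hbot
    rw [Real.cos_zero] at this
    refine this.congr fun t => ?_
    rw [Function.comp_apply, ← Real.cos_abs (c * (α t - A)), abs_mul, abs_of_nonneg hc]
  have hWbot : Tendsto W atBot (𝓝 (1 / 2)) := by simpa using hVbot.mul hcosbot
  have hlim : Tendsto (fun R => ENNReal.ofReal (V R + W (-R))) atTop (𝓝 1) := by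
    have := ENNReal.tendsto_ofReal (hVtop.add (hWbot.comp tendsto_neg_atTop_atBot))
    norm_num at this
    exact this
  exact le_of_tendsto hlim (by filter_upwards [eventually_ge_atTop |T|] with R hR using bound R hR)

/-! ### Upper bound: the chord competitor -/

theorem setLIntegral_exp_Ioi {k : ℝ} (hk : 0 ≤ k) (T : ℝ) :
    ∫⁻ t in Ioi T, ENNReal.ofReal (k * Real.exp (T - t)) = ENNReal.ofReal k := by
  have e : (fun t => k * Real.exp (T - t)) = fun t => k * Real.exp T * Real.exp (-t) := by
    funext t
    rw [sub_eq_add_neg, Real.exp_add]; ring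
  rw [← ofReal_integral_eq_lintegral_ofReal]
  · rw [e, integral_const_mul, integral_exp_neg_Ioi, mul_assoc, ← Real.exp_add]
    simp
  · rw [e]
    have := integrableOn_exp_mul_Ioi (a := -1) (by norm_num) T
    simp only [neg_one_mul] at this
    exact this.const_mul _
  · exact Eventually.of_forall fun t => by positivity

theorem setLIntegral_exp_Iic {k : ℝ} (hk : 0 ≤ k) (T : ℝ) :
    ∫⁻ t in Iic (-T), ENNReal.ofReal (k * Real.exp (T + t)) = ENNReal.ofReal k := by
  have e : (fun t => k * Real.exp (T + t)) = fun t => k * Real.exp T * Real.exp t := by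
    funext t
    rw [Real.exp_add]; ring
  rw [← ofReal_integral_eq_lintegral_ofReal]
  · rw [e, integral_const_mul, integral_exp_Iic, mul_assoc, ← Real.exp_add]
    simp
  · rw [e]
    exact (integrableOn_exp_Iic _).const_mul _
  · exact Eventually.of_forall fun t => by positivity

/-- The chord of a flat cone at distance `d` from the pole, followed by radial segments. -/
noncomputable def chordBeta (δ d T t : ℝ) : ℝ :=
  √(d ^ 2 + min |t| T ^ 2 / 4) + (1 - δ) * (1 - Real.exp (-max (|t| - T) 0 / 2))

noncomputable def chordBetaDeriv (δ d T t : ℝ) : ℝ :=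
  if |t| < T then t / (4 * √(d ^ 2 + t ^ 2 / 4))
  else if 0 < t then (1 - δ) / 2 * Real.exp ((T - t) / 2)
  else -((1 - δ) / 2 * Real.exp ((T + t) / 2))

/-- In the plane with polar radius `β` and polar angle `C * α`, the arc `|t| ≤ T` is the segment
`(d, t / 2)`, run at speed `1 / 2`. -/
noncomputable def chordAlpha (C d T t : ℝ) : ℝ :=
  Real.arctan (max (-T) (min t T) / (2 * d)) / C

noncomputable def chordAlphaDeriv (C d T t : ℝ) : ℝ :=
  if |t| < T then d / (2 * C * (d ^ 2 + t ^ 2 / 4)) else 0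

theorem abs_lt_or_lt_or_lt_neg {T t : ℝ} (ht : t ∉ ({T, -T} : Set ℝ)) :
    |t| < T ∨ T < t ∨ t < -T := by
  simp only [mem_insert_iff, mem_singleton_iff, not_or] at ht
  rcases lt_trichotomy t T with h | h | h
  · rcases lt_trichotomy t (-T) with h' | h' | h'
    · exact Or.inr (Or.inr h')
    · exact absurd h' ht.2
    · exact Or.inl (abs_lt.2 ⟨h', h⟩)
  · exact absurd h ht.1
  · exact Or.inr (Or.inl h)

section Chord

variable {C δ d T : ℝ}

theorem chordBeta_of_abs_le {t : ℝ} (ht : |t| ≤ T) : chordBeta δ d T t = √(d ^ 2 + t ^ 2 / 4) := by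
  rw [chordBeta, min_eq_left ht, max_eq_right (by linarith), sq_abs]
  simp

/-- `hdT` places the endpoints of the chord at radius `δ`, where the radial pieces start. -/
theorem chordBeta_of_le_abs (hδ : 0 ≤ δ) (hdT : d ^ 2 + T ^ 2 / 4 = δ ^ 2) {t : ℝ} (ht : T ≤ |t|) :
    chordBeta δ d T t = 1 - (1 - δ) * Real.exp ((T - |t|) / 2) := by
  rw [chordBeta, min_eq_right ht, max_eq_left (by linarith), hdT, Real.sqrt_sq hδ, neg_sub]
  ring

theorem continuous_chordBeta : Continuous (chordBeta δ d T) := by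
  unfold chordBeta
  fun_prop

theorem measurable_chordBetaDeriv : Measurable (chordBetaDeriv δ d T) := by
  unfold chordBetaDeriv
  refine Measurable.ite (measurableSet_lt (by fun_prop) (by fun_prop)) (by fun_prop) ?_
  exact Measurable.ite (measurableSet_lt (by fun_prop) (by fun_prop)) (by fun_prop) (by fun_prop)

theorem measurable_chordAlphaDeriv : Measurable (chordAlphaDeriv C d T) := by
  unfold chordAlphaDeriv
  exact Measurable.ite (measurableSet_lt (by fun_prop) (by fun_prop)) (by fun_prop) (by fun_prop)

theorem continuous_chordAlpha : Continuous (chordAlpha C d T) := by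
  unfold chordAlpha
  fun_prop

theorem hasDerivAt_chordBeta (hδ : 0 ≤ δ) (hd : 0 < d) (hT : 0 < T)
    (hdT : d ^ 2 + T ^ 2 / 4 = δ ^ 2) {t : ℝ} (ht : t ∉ ({T, -T} : Set ℝ)) :
    HasDerivAt (chordBeta δ d T) (chordBetaDeriv δ d T t) t := by
  rcases abs_lt_or_lt_or_lt_neg ht with h | h | h
  · have hev : chordBeta δ d T =ᶠ[𝓝 t] fun t => √(d ^ 2 + t ^ 2 / 4) := by
      filter_upwards [(continuous_abs.continuousAt (x := t)).eventually (gt_mem_nhds h)] with x hx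
      exact chordBeta_of_abs_le (le_of_lt hx)
    have hpos : 0 < d ^ 2 + t ^ 2 / 4 := by positivity
    have := ((((hasDerivAt_id t).pow 2).div_const 4).const_add (d ^ 2)).sqrt hpos.ne'
    rw [chordBetaDeriv, if_pos h]
    refine (this.congr_of_eventuallyEq hev).congr_deriv ?_
    have : √(d ^ 2 + t ^ 2 / 4) ≠ 0 := (Real.sqrt_pos.2 hpos).ne'
    simp
    field_simp
  · have ht0 : 0 < t := hT.trans h
    have hev : chordBeta δ d T =ᶠ[𝓝 t] fun t => 1 - (1 - δ) * Real.exp ((T - t) / 2) := by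
      filter_upwards [lt_mem_nhds h] with x hx
      rw [chordBeta_of_le_abs hδ hdT (hx.le.trans (le_abs_self x)), abs_of_pos (hT.trans hx)]
    have := ((((hasDerivAt_id t).const_sub T).div_const 2).exp.const_mul (1 - δ)).const_sub 1
    rw [chordBetaDeriv, if_neg (by rw [abs_of_pos ht0]; linarith), if_pos ht0]
    refine (this.congr_of_eventuallyEq hev).congr_deriv ?_
    simp only [id]; ring
  · have ht0 : t < 0 := by linarith
    have hev : chordBeta δ d T =ᶠ[𝓝 t] fun t => 1 - (1 - δ) * Real.exp ((T + t) / 2) := by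
      filter_upwards [gt_mem_nhds h] with x hx
      have hx0 : x < 0 := by linarith
      rw [chordBeta_of_le_abs hδ hdT (by rw [abs_of_neg hx0]; linarith), abs_of_neg hx0,
        sub_neg_eq_add]
    have := ((((hasDerivAt_id t).const_add T).div_const 2).exp.const_mul (1 - δ)).const_sub 1
    rw [chordBetaDeriv, if_neg (by rw [abs_of_neg ht0]; linarith), if_neg (by linarith)]
    refine (this.congr_of_eventuallyEq hev).congr_deriv ?_
    simp only [id]; ring

theorem hasDerivAt_chordAlpha (hC : 0 < C) (hd : 0 < d) (hT : 0 < T) {t : ℝ}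
    (ht : t ∉ ({T, -T} : Set ℝ)) :
    HasDerivAt (chordAlpha C d T) (chordAlphaDeriv C d T t) t := by
  rcases abs_lt_or_lt_or_lt_neg ht with h | h | h
  · have hev : chordAlpha C d T =ᶠ[𝓝 t] fun t => Real.arctan (t / (2 * d)) / C := by
      filter_upwards [(continuous_abs.continuousAt (x := t)).eventually (gt_mem_nhds h)] with x hx
      have hx' := abs_lt.1 hx
      rw [chordAlpha, min_eq_left hx'.2.le, max_eq_right hx'.1.le]
    have := (((hasDerivAt_id t).div_const (2 * d)).arctan).div_const C
    rw [chordAlphaDeriv, if_pos h]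
    refine (this.congr_of_eventuallyEq hev).congr_deriv ?_
    have : 0 < d ^ 2 + t ^ 2 / 4 := by positivity
    have h2 : 0 < (2 * d) ^ 2 + t ^ 2 := by positivity
    simp only [id]
    field_simp
    ring
  · have hev : chordAlpha C d T =ᶠ[𝓝 t] fun _ => Real.arctan (T / (2 * d)) / C := by
      filter_upwards [lt_mem_nhds h] with x hx
      rw [chordAlpha, min_eq_right hx.le, max_eq_right (by linarith)]
    rw [chordAlphaDeriv, if_neg (by rw [abs_of_pos (hT.trans h)]; linarith)]
    exact (hasDerivAt_const _ _).congr_of_eventuallyEq hev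
  · have hev : chordAlpha C d T =ᶠ[𝓝 t] fun _ => Real.arctan (-T / (2 * d)) / C := by
      filter_upwards [gt_mem_nhds h] with x hx
      rw [chordAlpha, min_eq_left (by linarith), max_eq_left hx.le]
    rw [chordAlphaDeriv, if_neg (by rw [abs_of_neg (by linarith)]; linarith)]
    exact (hasDerivAt_const _ _).congr_of_eventuallyEq hev

theorem abs_chordBetaDeriv_le (hδ : 0 ≤ δ) (hδ1 : δ ≤ 1) (hd : 0 < d) (t : ℝ) :
    |chordBetaDeriv δ d T t| ≤ 1 / 2 := by
  have hexp : ∀ x : ℝ, x ≤ 0 → |(1 - δ) / 2 * Real.exp x| ≤ 1 / 2 := fun x hx => by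
    rw [abs_of_nonneg (mul_nonneg (by linarith) (Real.exp_pos _).le)]
    have := Real.exp_le_one_iff.2 hx
    nlinarith [Real.exp_pos x]
  unfold chordBetaDeriv
  split_ifs with h1 h2
  · have hpos : 0 < √(d ^ 2 + t ^ 2 / 4) := Real.sqrt_pos.2 (by positivity)
    have : |t| / 2 ≤ √(d ^ 2 + t ^ 2 / 4) := by
      apply Real.le_sqrt_of_sq_le
      rw [div_pow, sq_abs]
      nlinarith [sq_nonneg d]
    rw [abs_div, abs_of_pos (a := 4 * _) (by positivity), div_le_iff₀ (by positivity)]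
    linarith
  · refine hexp _ ?_
    rw [abs_of_pos h2] at h1
    linarith
  · rw [abs_neg]
    refine hexp _ ?_
    rw [abs_of_nonpos (by linarith)] at h1
    linarith

theorem abs_chordAlphaDeriv_le (hC : 0 < C) (hd : 0 < d) (t : ℝ) :
    |chordAlphaDeriv C d T t| ≤ d / (2 * C * d ^ 2) := by
  unfold chordAlphaDeriv
  split_ifs
  · rw [abs_of_pos (by positivity)]
    have : d ^ 2 ≤ d ^ 2 + t ^ 2 / 4 := by linarith [sq_nonneg t]
    gcongr
  · rw [abs_zero]; positivity

theorem chordBeta_mem_Icc (hδ : 0 ≤ δ) (hδ1 : δ ≤ 1) (hT : 0 < T)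
    (hdT : d ^ 2 + T ^ 2 / 4 = δ ^ 2) (t : ℝ) : 0 ≤ chordBeta δ d T t ∧ chordBeta δ d T t ≤ 1 := by
  rcases le_total |t| T with h | h
  · rw [chordBeta_of_abs_le h]
    refine ⟨Real.sqrt_nonneg _, Real.sqrt_le_one.2 ?_⟩
    have : t ^ 2 ≤ T ^ 2 := sq_le_sq.2 (by rwa [abs_of_pos hT])
    nlinarith
  · rw [chordBeta_of_le_abs hδ hdT h]
    have := Real.exp_le_one_iff.2 (show (T - |t|) / 2 ≤ 0 by linarith)
    have := Real.exp_pos ((T - |t|) / 2)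
    constructor <;> nlinarith

theorem tendsto_chordBeta (hδ : 0 ≤ δ) (hdT : d ^ 2 + T ^ 2 / 4 = δ ^ 2) {l : Filter ℝ}
    (hl : Tendsto (fun t : ℝ => |t|) l atTop) : Tendsto (chordBeta δ d T) l (𝓝 1) := by
  have h1 : Tendsto (fun t : ℝ => (T - |t|) / 2) l atBot :=
    (tendsto_atBot_add_const_left _ T (tendsto_neg_atTop_atBot.comp hl)).atBot_div_const two_pos
  have h2 := ((Real.tendsto_exp_atBot.comp h1).const_mul (1 - δ)).const_sub 1
  rw [mul_zero, sub_zero] at h2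
  refine h2.congr' ?_
  filter_upwards [hl.eventually_ge_atTop T] with t ht
  rw [chordBeta_of_le_abs hδ hdT ht]
  rfl

theorem isAdmissible_chord {s : ℝ} (hC : 0 < C) (hδ : 0 ≤ δ) (hδ1 : δ ≤ 1) (hd : 0 < d) (hT : 0 < T)
    (hdT : d ^ 2 + T ^ 2 / 4 = δ ^ 2) (hs : 2 * Real.arctan (T / (2 * d)) / C = s) (hs0 : 0 ≤ s) :
    IsAdmissible s (chordAlpha C d T) (chordAlphaDeriv C d T) (chordBeta δ d T)
      (chordBetaDeriv δ d T) := by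
  have hS : ({T, -T} : Set ℝ).Countable := (Set.toFinite _).countable
  have hα : IsH1Loc (chordAlpha C d T) (chordAlphaDeriv C d T) :=
    isH1Loc_of_hasDerivAt_off_countable hS continuous_chordAlpha measurable_chordAlphaDeriv
      (abs_chordAlphaDeriv_le hC hd) fun t ht => hasDerivAt_chordAlpha hC hd hT ht
  have hsupp : ∀ t ∉ Ioc (-T) T, chordAlphaDeriv C d T t = 0 := fun t ht => by
    rw [chordAlphaDeriv, if_neg fun h => ht ⟨(abs_lt.1 h).1, (abs_lt.1 h).2.le⟩]
  refine ⟨hα, isH1Loc_of_hasDerivAt_off_countable hS continuous_chordBeta measurable_chordBetaDeriv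
      (abs_chordBetaDeriv_le hδ hδ1 hd) fun t ht => hasDerivAt_chordBeta hδ hd hT hdT ht, ?_, ?_,
    fun t => (chordBeta_mem_Icc hδ hδ1 hT hdT t).1, fun t => (chordBeta_mem_Icc hδ hδ1 hT hdT t).2,
    tendsto_chordBeta hδ hdT tendsto_abs_atTop_atTop,
    tendsto_chordBeta hδ hdT tendsto_abs_atBot_atTop⟩
  · rw [← integrableOn_iff_integrable_of_support_subset (s := Ioc (-T) T)
      (fun t ht => by_contra fun h => ht (hsupp t h))]
    exact (hα.locallyIntegrable.integrableOn_isCompact isCompact_Icc).mono_set Ioc_subset_Icc_self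
  · rw [← setIntegral_eq_integral_of_forall_compl_eq_zero hsupp,
      ← intervalIntegral.integral_of_le (by linarith), hα.integral_eq_sub]
    have : chordAlpha C d T T - chordAlpha C d T (-T) = s := by
      rw [← hs]
      simp only [chordAlpha, min_self]
      rw [min_eq_left (by linarith), max_self, max_eq_right (by linarith), neg_div,
        Real.arctan_neg]
      ring
    rw [this, abs_of_nonneg hs0]

/-- Since `f b ≤ C * b`, the kinetic part is at most the squared Euclidean speed `1 / 4` of the
segment; the potential part is at most `1 / 4`. -/
theorem integrand_chord_le_inner {f : ℝ → ℝ} (hC : 0 < C) (hδ : 0 ≤ δ) (hδ1 : δ < 1) (hd : 0 < d)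
    (hT : 0 < T) (hdT : d ^ 2 + T ^ 2 / 4 = δ ^ 2)
    (hf : ∀ b, 0 ≤ b → b ≤ δ → 0 ≤ f b ∧ f b ≤ C * b) {t : ℝ} (ht : |t| < T) :
    extend f (chordBeta δ d T t) ^ 2 * ENNReal.ofReal (|chordAlphaDeriv C d T t| ^ 2)
      + ENNReal.ofReal ((1 - chordBeta δ d T t) ^ 2 / 4)
      + ENNReal.ofReal (|chordBetaDeriv δ d T t| ^ 2) ≤ ENNReal.ofReal (1 / 2) := by
  rw [chordBeta_of_abs_le ht.le, chordAlphaDeriv, chordBetaDeriv, if_pos ht, if_pos ht]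
  have hpos : 0 < d ^ 2 + t ^ 2 / 4 := by positivity
  set b := √(d ^ 2 + t ^ 2 / 4) with hb
  have hb2 : b ^ 2 = d ^ 2 + t ^ 2 / 4 := Real.sq_sqrt hpos.le
  have hb0 : 0 < b := Real.sqrt_pos.2 hpos
  have hbδ : b ≤ δ := by
    have : t ^ 2 ≤ T ^ 2 := sq_le_sq.2 (by rw [abs_of_pos hT]; exact ht.le)
    exact Real.sqrt_le_iff.2 ⟨hδ, by linarith⟩
  obtain ⟨hf0, hfC⟩ := hf b hb0.le hbδ
  rw [extend, if_pos (hbδ.trans_lt hδ1), ← ENNReal.ofReal_pow hf0,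
    ← ENNReal.ofReal_mul (by positivity), ← ENNReal.ofReal_add (by positivity) (by positivity),
    ← ENNReal.ofReal_add (by positivity) (by positivity)]
  refine ENNReal.ofReal_le_ofReal ?_
  rw [sq_abs, sq_abs, ← hb2]
  have h1 : f b ^ 2 * (d / (2 * C * b ^ 2)) ^ 2 ≤ (C * b) ^ 2 * (d / (2 * C * b ^ 2)) ^ 2 := by
    gcongr
  have h2 : (C * b) ^ 2 * (d / (2 * C * b ^ 2)) ^ 2 + (t / (4 * b)) ^ 2 = 1 / 4 := by
    have : (C * b) ^ 2 * (d / (2 * C * b ^ 2)) ^ 2 + (t / (4 * b)) ^ 2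
        = (d ^ 2 + t ^ 2 / 4) / (4 * b ^ 2) := by
      field_simp
      ring
    rw [this, ← hb2]
    field_simp
  have h3 : (1 - b) ^ 2 ≤ 1 := by nlinarith
  linarith

/-- The exponential profile solves `|β'| = (1 - β) / 2`, the equality case of the inequality between
energy and length, and `α'` vanishes. -/
theorem integrand_chord_outer {f : ℝ → ℝ} (hδ : 0 ≤ δ) (hδ1 : δ ≤ 1)
    (hdT : d ^ 2 + T ^ 2 / 4 = δ ^ 2) {t : ℝ} (ht : T ≤ |t|) :
    extend f (chordBeta δ d T t) ^ 2 * ENNReal.ofReal (|chordAlphaDeriv C d T t| ^ 2)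
      + ENNReal.ofReal ((1 - chordBeta δ d T t) ^ 2 / 4)
      + ENNReal.ofReal (|chordBetaDeriv δ d T t| ^ 2)
      = ENNReal.ofReal ((1 - δ) ^ 2 / 2 * Real.exp (T - |t|)) := by
  have hβ : |chordBetaDeriv δ d T t| = (1 - δ) / 2 * Real.exp ((T - |t|) / 2) := by
    have h0 : 0 ≤ 1 - δ := by linarith
    rw [chordBetaDeriv, if_neg ht.not_gt]
    split_ifs with h
    · rw [abs_of_nonneg (by positivity), abs_of_pos h]
    · rw [abs_neg, abs_of_nonneg (by positivity), abs_of_nonpos (not_lt.1 h), sub_neg_eq_add]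
  rw [hβ, chordBeta_of_le_abs hδ hdT ht, chordAlphaDeriv, if_neg ht.not_gt]
  have e : Real.exp (T - |t|) = Real.exp ((T - |t|) / 2) ^ 2 := by
    rw [← Real.exp_nat_mul]; congr 1; push_cast; ring
  simp only [abs_zero, ne_eq, OfNat.ofNat_ne_zero, not_false_eq_true, zero_pow, ENNReal.ofReal_zero,
    mul_zero, zero_add]
  rw [← ENNReal.ofReal_add (by positivity) (by positivity), e]
  congr 1
  ring

theorem energy_chord_le {f : ℝ → ℝ} (hC : 0 < C) (hδ : 0 ≤ δ) (hδ1 : δ < 1) (hd : 0 < d)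
    (hT : 0 < T) (hdT : d ^ 2 + T ^ 2 / 4 = δ ^ 2)
    (hf : ∀ b, 0 ≤ b → b ≤ δ → 0 ≤ f b ∧ f b ≤ C * b) :
    energy f (chordAlphaDeriv C d T) (chordBeta δ d T) (chordBetaDeriv δ d T) ≤
      ENNReal.ofReal (T + (1 - δ) ^ 2) := by
  set I : ℝ → ℝ≥0∞ := fun t =>
    extend f (chordBeta δ d T t) ^ 2 * ENNReal.ofReal (|chordAlphaDeriv C d T t| ^ 2)
      + ENNReal.ofReal ((1 - chordBeta δ d T t) ^ 2 / 4)
      + ENNReal.ofReal (|chordBetaDeriv δ d T t| ^ 2) with hI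
  have houter : ∀ t, T ≤ |t| → I t = ENNReal.ofReal ((1 - δ) ^ 2 / 2 * Real.exp (T - |t|)) :=
    fun t ht => integrand_chord_outer hδ hδ1.le hdT ht
  have h1 : ∫⁻ t in Ioi T, I t = ENNReal.ofReal ((1 - δ) ^ 2 / 2) := by
    rw [← setLIntegral_exp_Ioi (by positivity) T]
    refine setLIntegral_congr_fun measurableSet_Ioi fun t ht => ?_
    have ht' : T < t := ht
    simp only [houter t (ht'.le.trans (le_abs_self t)), abs_of_pos (hT.trans ht')]
  have h2 : ∫⁻ t in Iic (-T), I t = ENNReal.ofReal ((1 - δ) ^ 2 / 2) := by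
    rw [← setLIntegral_exp_Iic (by positivity) T]
    refine setLIntegral_congr_fun measurableSet_Iic fun t ht => ?_
    have ht' : t ≤ -T := ht
    have hneg : |t| = -t := abs_of_nonpos (by linarith)
    simp only [houter t (by rw [hneg]; linarith), hneg, sub_neg_eq_add]
  have h3 : ∫⁻ t in Ioc (-T) T, I t ≤ ENNReal.ofReal T := by
    calc ∫⁻ t in Ioc (-T) T, I t ≤ ∫⁻ _ in Ioc (-T) T, ENNReal.ofReal (1 / 2) := by
          refine setLIntegral_mono' measurableSet_Ioc fun t ht => ?_
          -- The endpoint `t = T` lies in `Ioc (-T) T` but falls under the outer formula.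
          rcases lt_or_ge |t| T with h | h
          · exact integrand_chord_le_inner hC hδ hδ1 hd hT hdT hf h
          · rw [houter t h]
            refine ENNReal.ofReal_le_ofReal ?_
            have := Real.exp_le_one_iff.2 (show T - |t| ≤ 0 by linarith)
            have := Real.exp_pos (T - |t|)
            have : (1 - δ) ^ 2 ≤ 1 := by nlinarith
            nlinarith [sq_nonneg (1 - δ)]
      _ = ENNReal.ofReal T := by
          rw [setLIntegral_const, Real.volume_Ioc, ← ENNReal.ofReal_mul (by norm_num)]
          congr 1; ring
  have hsplit : ∫⁻ t, I t = (∫⁻ t in Iic (-T), I t) + (∫⁻ t in Ioc (-T) T, I t)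
      + ∫⁻ t in Ioi T, I t := by
    rw [← lintegral_union measurableSet_Ioc (Iic_disjoint_Ioc le_rfl),
      Iic_union_Ioc_eq_Iic (by linarith), ← lintegral_union measurableSet_Ioi
      (Iic_disjoint_Ioi le_rfl), Iic_union_Ioi, setLIntegral_univ]
  change ∫⁻ t, I t ≤ _
  rw [hsplit, h1, h2]
  calc _ ≤ ENNReal.ofReal ((1 - δ) ^ 2 / 2) + ENNReal.ofReal T + ENNReal.ofReal ((1 - δ) ^ 2 / 2) := by
        gcongr
    _ = _ := by
        rw [← ENNReal.ofReal_add (by positivity) hT.le,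
          ← ENNReal.ofReal_add (by positivity) (by positivity)]
        congr 1; ring

end Chord

/-! ### The threshold -/

/-- The chord is the base of an isosceles triangle with legs `δ` and apex angle `C * s = 2 * θ`,
whence `d = δ * cos θ` and `T = 2 * δ * sin θ`. It costs at most `2 * δ * sin θ`, whereas passing
through the apex instead would cost `2 * δ - δ ^ 2`; `hsin` says exactly that the chord bound is
smaller. -/
theorem g_lt_one {f : ℝ → ℝ} {C δ s : ℝ} (hC : 0 < C) (hs : 0 < s) (hCs : C * s < Real.pi)
    (hδ : 0 < δ) (hδ1 : δ < 1) (hsin : Real.sin (C * s / 2) < 1 - δ / 2)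
    (hf : ∀ b, 0 ≤ b → b ≤ δ → 0 ≤ f b ∧ f b ≤ C * b) : g f s < 1 := by
  set θ := C * s / 2 with hθ
  have hCs0 : 0 < C * s := mul_pos hC hs
  have hθ0 : 0 < θ := by positivity
  have hθ1 : θ < Real.pi / 2 := by linarith
  have hcos : 0 < Real.cos θ := Real.cos_pos_of_mem_Ioo ⟨by linarith, hθ1⟩
  have hsin0 : 0 < Real.sin θ := Real.sin_pos_of_pos_of_lt_pi hθ0 (by linarith)
  have hdT : (δ * Real.cos θ) ^ 2 + (2 * δ * Real.sin θ) ^ 2 / 4 = δ ^ 2 := by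
    linear_combination δ ^ 2 * Real.sin_sq_add_cos_sq θ
  have hd : 0 < δ * Real.cos θ := by positivity
  have hT : 0 < 2 * δ * Real.sin θ := by positivity
  have harc : 2 * Real.arctan (2 * δ * Real.sin θ / (2 * (δ * Real.cos θ))) / C = s := by
    have : 2 * δ * Real.sin θ / (2 * (δ * Real.cos θ)) = Real.tan θ := by
      rw [Real.tan_eq_sin_div_cos]; field_simp
    rw [this, Real.arctan_tan (by linarith) hθ1, hθ]
    field_simp
  have hadm := isAdmissible_chord hC hδ.le hδ1.le hd hT hdT harc hs.le
  calc g f s ≤ energy f (chordAlphaDeriv C (δ * Real.cos θ) (2 * δ * Real.sin θ))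
        (chordBeta δ (δ * Real.cos θ) (2 * δ * Real.sin θ))
        (chordBetaDeriv δ (δ * Real.cos θ) (2 * δ * Real.sin θ)) :=
        iInf_le_of_le _ (iInf_le_of_le _ (iInf_le_of_le _ (iInf_le_of_le _ (iInf_le _ hadm))))
    _ ≤ ENNReal.ofReal (2 * δ * Real.sin θ + (1 - δ) ^ 2) :=
        energy_chord_le hC hδ.le hδ1 hd hT hdT hf
    _ < 1 := by
        rw [ENNReal.ofReal_lt_one]
        nlinarith

theorem g_lt_one_of_mul_lt_pi {f : ℝ → ℝ} (hf : ContDiffOn ℝ 2 f (Ico 0 1)) (h0 : f 0 = 0)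
    (hnn : ∀ s ∈ Ico (0 : ℝ) 1, 0 ≤ f s) {s : ℝ} (hs : 0 < s) (hcs : derivZero f * s < Real.pi) :
    g f s < 1 := by
  obtain ⟨C, hcC, hCs⟩ := exists_between ((lt_div_iff₀ hs).2 hcs)
  have hC : 0 < C := (derivZero_nonneg hf h0 hnn).trans_lt hcC
  rw [lt_div_iff₀ hs] at hCs
  have hCs0 : 0 < C * s := mul_pos hC hs
  have hsin : Real.sin (C * s / 2) < 1 := by
    rw [← Real.sin_pi_div_two]
    exact Real.sin_lt_sin_of_lt_of_le_pi_div_two (by linarith) le_rfl (by linarith)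
  obtain ⟨η, hη0 : 0 < η, hη⟩ := mem_nhdsGT_iff_exists_Ioo_subset.1
    ((tendsto_div_derivZero hf h0).eventually (gt_mem_nhds hcC))
  -- The first bound keeps `f b ≤ C * b` up to `δ`; the second gives both `δ < 1` and `sin (C * s /
  -- 2) < 1 - δ / 2`.
  set δ := min (η / 2) (1 - Real.sin (C * s / 2)) with hδdef
  have hδ : 0 < δ := lt_min (by linarith) (by linarith)
  have hδ2 : δ ≤ 1 - Real.sin (C * s / 2) := min_le_right _ _
  have hsin0 : 0 < Real.sin (C * s / 2) :=
    Real.sin_pos_of_pos_of_lt_pi (by linarith) (by linarith [Real.pi_pos])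
  refine g_lt_one hC hs hCs hδ (by linarith) (by linarith) fun b hb hbδ => ?_
  refine ⟨hnn b ⟨hb, by linarith⟩, ?_⟩
  rcases hb.eq_or_lt with rfl | hb0
  · simp [h0]
  · have hbη : b < η := by
      have : δ ≤ η / 2 := min_le_left _ _
      linarith
    have : f b / b < C := hη ⟨hb0, hbη⟩
    exact ((div_lt_iff₀ hb0).1 this).le

theorem sFrac_le {f : ℝ → ℝ} (hf : ContDiffOn ℝ 2 f (Ico 0 1)) (h0 : f 0 = 0)
    (hnn : ∀ s ∈ Ico (0 : ℝ) 1, 0 ≤ f s)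
    (hconv : ConvexOn ℝ (Ioc 0 1) (fun s : ℝ => √s * f (1 - √s))) (hc : 0 < derivZero f) :
    sFrac f ≤ ENNReal.ofReal (Real.pi / derivZero f) := by
  refine sSup_le ?_
  rintro _ ⟨s, ⟨_, hgs⟩, rfl⟩
  refine ENNReal.ofReal_le_ofReal ?_
  by_contra h
  rw [not_le, div_lt_iff₀' hc] at h
  refine hgs.not_ge ?_
  exact le_iInf fun α => le_iInf fun α' => le_iInf fun β => le_iInf fun β' => le_iInf fun hadm =>
    one_le_energy hc.le (fun b hb => ⟨hnn b hb, derivZero_mul_le hf h0 hconv hb⟩) hadm h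

theorem ofReal_le_sFrac {f : ℝ → ℝ} (hf : ContDiffOn ℝ 2 f (Ico 0 1)) (h0 : f 0 = 0)
    (hnn : ∀ s ∈ Ico (0 : ℝ) 1, 0 ≤ f s) {s : ℝ} (hs : 0 < s) (hcs : derivZero f * s < Real.pi) :
    ENNReal.ofReal s ≤ sFrac f :=
  le_sSup ⟨s, ⟨hs.le, g_lt_one_of_mul_lt_pi hf h0 hnn hs hcs⟩, rfl⟩

end CohesiveFracture
theorem proposition3p6 (f : ℝ → ℝ) (σc : ℝ)
    (hf1_smooth : ContDiffOn ℝ 2 f (Ico 0 1))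
    (hf1_nonneg : ∀ s ∈ Ico (0 : ℝ) 1, 0 ≤ f s)
    (hf1_zero : ∀ s ∈ Ico (0 : ℝ) 1, f s = 0 ↔ s = 0)
    (hσc : 0 < σc)
    (hf2 : Tendsto (fun s : ℝ => (1 - s) * f s) (𝓝[<] 1) (𝓝 σc))
    (hf3 : ∀ s ∈ Ioo (0 : ℝ) 1, 0 < deriv (fun x : ℝ => (1 - x) * f x) s)
    (hf4 : ∀ s ∈ Ioo (0 : ℝ) 1, deriv (fun x : ℝ => (1 - x) * deriv f x / f x) s < 0)
    (hf5 : Tendsto (fun s : ℝ => 1 / (1 - s) ^ 3 * deriv (fun x : ℝ => (1 - x) * f x) s)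
      (𝓝[<] 1) atTop)
    (hf6 : ConvexOn ℝ (Ioc 0 1) (fun s : ℝ => √s * f (1 - √s))) :
    0 ≤ CohesiveFracture.derivZero f ∧
    (0 < CohesiveFracture.derivZero f →
      CohesiveFracture.sFrac f = ENNReal.ofReal (Real.pi / CohesiveFracture.derivZero f)) ∧
    (CohesiveFracture.derivZero f = 0 → CohesiveFracture.sFrac f = ⊤) := by
  have h0 : f 0 = 0 := (hf1_zero 0 (by simp)).2 rfl
  refine ⟨CohesiveFracture.derivZero_nonneg hf1_smooth h0 hf1_nonneg, fun hc => ?_, fun hc => ?_⟩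
  · refine le_antisymm (CohesiveFracture.sFrac_le hf1_smooth h0 hf1_nonneg hf6 hc) ?_
    have hpos : 0 < Real.pi / CohesiveFracture.derivZero f := div_pos Real.pi_pos hc
    have hlim : Tendsto ENNReal.ofReal (𝓝[<] (Real.pi / CohesiveFracture.derivZero f))
        (𝓝 (ENNReal.ofReal (Real.pi / CohesiveFracture.derivZero f))) :=
      (ENNReal.continuous_ofReal.tendsto _).mono_left nhdsWithin_le_nhds
    -- The competitor needs a strict inequality, so the threshold is approached from below.
    refine le_of_tendsto hlim ?_
    filter_upwards [Ioo_mem_nhdsLT hpos] with s hs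
    exact CohesiveFracture.ofReal_le_sFrac hf1_smooth h0 hf1_nonneg hs.1 ((lt_div_iff₀' hc).1 hs.2)
  · refine top_unique (le_of_tendsto ENNReal.tendsto_ofReal_atTop ?_)
    filter_upwards [eventually_gt_atTop (0 : ℝ)] with s hs
    exact CohesiveFracture.ofReal_le_sFrac hf1_smooth h0 hf1_nonneg hs
      (by rw [hc, zero_mul]; exact Real.pi_pos)
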